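/- **Language and deductive system.** Formulas are built from countably many variables with the binary connectives $\wedge,\vee,\to,\cdot$, the unary connectives $\neg,\,!$ and the constants $1,0$ (multiplicative) and $\top,\bot$ (additive); $p\mathbin{⅋}q:=\neg p\to q$ and $?p:=\neg\,!\,\neg p$ are abbreviations. ($\cdot,\wedge,\vee$ bind more strongly than $\to$.) $\mathsf{LL}$ is the deductive system whose axioms are all substitution instances of - (HL1) $p\to p$; (HL2) $(p\to q)\to((q\to r)\to(p\to r))$; (HL3) $(p\to(q\to r))\to(q\to(p\to r))$; - (HL4) $\neg\neg p\to p$; (HL5) $(p\to\neg q)\to(q\to\neg p)$; - (HL6) $p\to(q\to p\cdot q)$; (HL7) $(p\to(q\to r))\to(p\cdot q\to r)$; - (HL8) $1$; (HL9) $1\to(p\to p)$; (HL10) $p\to(\neg p\to 0)$; (HL11) $\neg 0$; - (HL12) $p\wedge q\to p$; (HL13) $p\wedge q\to q$; (HL14) $(p\to q)\wedge(p\to r)\to(p\to q\wedge r)$; - (HL15) $p\to p\vee q$; (HL16) $q\to p\vee q$; (HL17) $(p\to r)\wedge(q\to r)\to(p\vee q\to r)$; - (HL18) $p\to\top$; (HL19)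 $\bot\to p$; - (HL20) $q\to(!p\to q)$; (HL21) $(!p\to(!p\to q))\to(!p\to q)$; (HL22) $!(p\to q)\to(!p\to\,!q)$; (HL23) $!p\to p$; (HL24) $!p\to\,!!p$, and whose rules are (MP) $p,\ p\to q\,/\,q$, (Adj) $p,\ q\,/\,p\wedge q$ and (Nec) $p\,/\,!p$. For a set $\Gamma$ of formulas, $\Gamma\vdash_{\mathsf{LL}}p$ means that $p$ is derivable from $\Gamma$ and the axioms by these rules. **Algebras.** A *bounded girale* is an algebra $\langle A,\wedge,\vee,\to,\cdot,\neg,!,1,0,\top,\bot\rangle$ such that $\langle A,\wedge,\vee\rangle$ is a lattice, $\langle A,\cdot,1\rangle$ is a commutative monoid, $ab\le c\iff b\le a\to c$ for all $a,b,c$ (so that we have a commutative residuated lattice), $(a\to 0)\to 0=a$ and $\neg a=a\to 0$ for all $a$ (a Girard algebra), $1\le a\to\top$ for all $a$ and $\bot=\neg\top$ (bounded), and for all $a,b$ $$(\mathrm{G1})\ \ !1=1,\qquad(\mathrm{G2})\ \ !a\le a\wedge 1,\qquad(\mathrm{G3})\ \ !a\cdot{!b}=\,!(a\wedge b),\qquad(\mathrm{G4})\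 \ !!a=\,!a .$$ **Algebraizability (Blok–Pigozzi).** For a class $\mathsf K$ of algebras of this type, $\Theta\vDash_{\mathsf K}\varepsilon\approx\delta$ means that in every member of $\mathsf K$ every assignment that satisfies all equations in $\Theta$ satisfies $\varepsilon\approx\delta$. $\mathsf K$ is an *equivalent algebraic semantics* of a deductive system (a finitary, substitution-invariant consequence relation) $\vdash$ if there are a finite set $E(p)$ of equations in one variable and a finite set $\Delta(p,q)$ of formulas in two variables such that, for all $\Gamma,p,q$, $$\Gamma\vdash p\iff\textstyle\bigcup_{r\in\Gamma}E(r)\vDash_{\mathsf K}E(p),\qquad\text{and}\qquad p\approx q\ \text{ and }\ \textstyle\bigcup_{r\in\Delta(p,q)}E(r)\ \text{ are interderivable in }\vDash_{\mathsf K}.$$ *The* equivalent algebraic semantics is the unique quasivariety (class axiomatized by quasi-equations) that is an equivalent algebraic semantics. The system is *strongly algebraizable* if it has such a quasivariety and this is a variety (a class axiomatized by equations). **Theorem.** $\mathsf{LL}$ is strongly algebraizable. The class $\mathcal G$ of all bounded girales is a variety, and it is the equivalent algebraic semantics of $\mathsf{LL}$: it is an equivalent algebraic semantics of $\mathsf{LL}$,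 and it is the only quasivariety that is one. -/

import Mathlib

universe u

namespace LinearLogic

/-- Formulas of propositional linear logic over countably many variables.  The constants `zero`
and `one` are multiplicative, `top` and `bot` are additive.  "Par" and "why not" are the
abbreviations `p ⅋ q := ¬p → q` and `?p := ¬!¬p`, hence not primitive.
The same type serves as the type of terms of the corresponding algebraic signature. -/
inductive Fm : Type
  | var : ℕ → Fm
  | meet : Fm → Fm → Fm
  | join : Fm → Fm → Fm
  | imp : Fm → Fm → Fm
  | mul : Fm → Fm → Fm
  | neg : Fm → Fm
  | bang : Fm → Fm
  | one : Fm
  | zero : Fm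
  | top : Fm
  | bot : Fm

namespace Fm

/-- Simultaneous substitution of formulas for variables. -/
def subst (σ : ℕ → Fm) : Fm → Fm
  | var n => σ n
  | meet p q => meet (subst σ p) (subst σ q)
  | join p q => join (subst σ p) (subst σ q)
  | imp p q => imp (subst σ p) (subst σ q)
  | mul p q => mul (subst σ p) (subst σ q)
  | neg p => neg (subst σ p)
  | bang p => bang (subst σ p)
  | one => one
  | zero => zero
  | top => top
  | bot => bot

/-- The set of variables that occur in a formula. -/
def vars : Fm → Set ℕ
  | var n => {n}
  | meet p q => vars p ∪ vars q
  | join p q => vars p ∪ vars q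
  | imp p q => vars p ∪ vars q
  | mul p q => vars p ∪ vars q
  | neg p => vars p
  | bang p => vars p
  | one => ∅
  | zero => ∅
  | top => ∅
  | bot => ∅

/-- `t.inst₁ p` is `t(p)`, for a formula `t` in the variable `0`. -/
def inst₁ (t p : Fm) : Fm := t.subst (fun _ => p)

/-- `t.inst₂ p q` is `t(p, q)`, for a formula `t` in the variables `0` and `1`. -/
def inst₂ (t p q : Fm) : Fm := t.subst (fun n => if n = 0 then p else q)

end Fm

infixr:60 " ⊸ " => Fm.imp
infixl:67 " ⋎ " => Fm.join
infixl:68 " ⋏ " => Fm.meet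
infixl:70 " ⊙ " => Fm.mul

/-- The instances of the twenty-four axiom schemes of linear logic. -/
inductive LLAxiom : Fm → Prop
  | hl1 (p : Fm) : LLAxiom (p ⊸ p)
  | hl2 (p q r : Fm) : LLAxiom ((p ⊸ q) ⊸ ((q ⊸ r) ⊸ (p ⊸ r)))
  | hl3 (p q r : Fm) : LLAxiom ((p ⊸ (q ⊸ r)) ⊸ (q ⊸ (p ⊸ r)))
  | hl4 (p : Fm) : LLAxiom (p.neg.neg ⊸ p)
  | hl5 (p q : Fm) : LLAxiom ((p ⊸ q.neg) ⊸ (q ⊸ p.neg))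
  | hl6 (p q : Fm) : LLAxiom (p ⊸ (q ⊸ p ⊙ q))
  | hl7 (p q r : Fm) : LLAxiom ((p ⊸ (q ⊸ r)) ⊸ (p ⊙ q ⊸ r))
  | hl8 : LLAxiom Fm.one
  | hl9 (p : Fm) : LLAxiom (Fm.one ⊸ (p ⊸ p))
  | hl10 (p : Fm) : LLAxiom (p ⊸ (p.neg ⊸ Fm.zero))
  | hl11 : LLAxiom Fm.zero.neg
  | hl12 (p q : Fm) : LLAxiom (p ⋏ q ⊸ p)
  | hl13 (p q : Fm) : LLAxiom (p ⋏ q ⊸ q)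
  | hl14 (p q r : Fm) : LLAxiom ((p ⊸ q) ⋏ (p ⊸ r) ⊸ (p ⊸ q ⋏ r))
  | hl15 (p q : Fm) : LLAxiom (p ⊸ p ⋎ q)
  | hl16 (p q : Fm) : LLAxiom (q ⊸ p ⋎ q)
  | hl17 (p q r : Fm) : LLAxiom ((p ⊸ r) ⋏ (q ⊸ r) ⊸ (p ⋎ q ⊸ r))
  | hl18 (p : Fm) : LLAxiom (p ⊸ Fm.top)
  | hl19 (p : Fm) : LLAxiom (Fm.bot ⊸ p)
  | hl20 (p q : Fm) : LLAxiom (q ⊸ (p.bang ⊸ q))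
  | hl21 (p q : Fm) : LLAxiom ((p.bang ⊸ (p.bang ⊸ q)) ⊸ (p.bang ⊸ q))
  | hl22 (p q : Fm) : LLAxiom ((p ⊸ q).bang ⊸ (p.bang ⊸ q.bang))
  | hl23 (p : Fm) : LLAxiom (p.bang ⊸ p)
  | hl24 (p : Fm) : LLAxiom (p.bang ⊸ p.bang.bang)

/-- `LLDerivable Γ p`: there is a Hilbert-style derivation of `p` from the set of premises `Γ`
by means of the axioms of linear logic and the rules of modus ponens, adjunction and necessitation
(all of which may be applied to formulas that depend on `Γ`). -/
inductive LLDerivable (Γ : Set Fm) : Fm → Prop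
  | hyp {p : Fm} : p ∈ Γ → LLDerivable Γ p
  | ax {p : Fm} : LLAxiom p → LLDerivable Γ p
  | mp {p q : Fm} : LLDerivable Γ p → LLDerivable Γ (p ⊸ q) → LLDerivable Γ q
  | adj {p q : Fm} : LLDerivable Γ p → LLDerivable Γ q → LLDerivable Γ (p ⋏ q)
  | nec {p : Fm} : LLDerivable Γ p → LLDerivable Γ p.bang

/-- A (1-dimensional) deductive system over the language of linear logic: a finitary,
substitution-invariant consequence relation between sets of formulas and formulas. -/
structure DeductiveSystem where
  cons : Set Fm → Fm → Prop
  refl : ∀ {Γ : Set Fm} {p : Fm}, p ∈ Γ → cons Γ p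
  cut : ∀ {Γ Δ : Set Fm} {p : Fm}, (∀ q ∈ Δ, cons Γ q) → cons Δ p → cons Γ p
  structural : ∀ {Γ : Set Fm} {p : Fm} (σ : ℕ → Fm), cons Γ p →
    cons (Fm.subst σ '' Γ) (p.subst σ)
  finitary : ∀ {Γ : Set Fm} {p : Fm}, cons Γ p → ∃ Γ' : Set Fm, Γ' ⊆ Γ ∧ Γ'.Finite ∧ cons Γ' p

theorem LLAxiom.subst {p : Fm} (σ : ℕ → Fm) (h : LLAxiom p) : LLAxiom (p.subst σ) := by
  cases h <;> constructor

theorem LLDerivable.cut {Γ Δ : Set Fm} {p : Fm} (h : ∀ q ∈ Δ, LLDerivable Γ q)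
    (hp : LLDerivable Δ p) : LLDerivable Γ p := by
  induction hp with
  | hyp hq => exact h _ hq
  | mp _ _ ih₁ ih₂ => exact .mp ih₁ ih₂
  | adj _ _ ih₁ ih₂ => exact .adj ih₁ ih₂
  | nec _ ih => exact .nec ih
  | ax h => exact .ax h

theorem LLDerivable.structural {Γ : Set Fm} {p : Fm} (σ : ℕ → Fm) (hp : LLDerivable Γ p) :
    LLDerivable (Fm.subst σ '' Γ) (p.subst σ) := by
  induction hp with
  | hyp hq => exact .hyp ⟨_, hq, rfl⟩
  | mp _ _ ih₁ ih₂ => exact .mp ih₁ ih₂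
  | adj _ _ ih₁ ih₂ => exact .adj ih₁ ih₂
  | nec _ ih => exact .nec ih
  | ax h => exact .ax (h.subst σ)

theorem LLDerivable.finitary {Γ : Set Fm} {p : Fm} (hp : LLDerivable Γ p) :
    ∃ Γ' : Set Fm, Γ' ⊆ Γ ∧ Γ'.Finite ∧ LLDerivable Γ' p := by
  induction hp with
  | @hyp q hq =>
    exact ⟨{q}, Set.singleton_subset_iff.2 hq, Set.finite_singleton q, .hyp rfl⟩
  | mp _ _ ih₁ ih₂ =>
    obtain ⟨A, hA, fA, dA⟩ := ih₁
    obtain ⟨B, hB, fB, dB⟩ := ih₂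
    exact ⟨A ∪ B, Set.union_subset hA hB, fA.union fB,
      .mp (dA.cut fun _ h => .hyp (Or.inl h)) (dB.cut fun _ h => .hyp (Or.inr h))⟩
  | adj _ _ ih₁ ih₂ =>
    obtain ⟨A, hA, fA, dA⟩ := ih₁
    obtain ⟨B, hB, fB, dB⟩ := ih₂
    exact ⟨A ∪ B, Set.union_subset hA hB, fA.union fB,
      .adj (dA.cut fun _ h => .hyp (Or.inl h)) (dB.cut fun _ h => .hyp (Or.inr h))⟩
  | nec _ ih =>
    obtain ⟨A, hA, fA, dA⟩ := ih
    exact ⟨A, hA, fA, .nec dA⟩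
  | ax h => exact ⟨∅, Set.empty_subset _, Set.finite_empty, .ax h⟩

/-- Linear logic as a deductive system. -/
def LL : DeductiveSystem where
  cons := LLDerivable
  refl := .hyp
  cut := LLDerivable.cut
  structural := LLDerivable.structural
  finitary := LLDerivable.finitary

/-- Algebras whose type is the language of linear logic (no laws are imposed here). -/
structure LLAlgebra where
  carrier : Type u
  meet : carrier → carrier → carrier
  join : carrier → carrier → carrier
  imp : carrier → carrier → carrier
  mul : carrier → carrier → carrier
  neg : carrier → carrier
  bang : carrier → carrier
  one : carrier
  zero : carrier
  top : carrier
  bot : carrier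

namespace LLAlgebra

/-- The value of a term under an assignment of elements to the variables. -/
def eval (A : LLAlgebra.{u}) (v : ℕ → A.carrier) : Fm → A.carrier
  | .var n => v n
  | .meet p q => A.meet (A.eval v p) (A.eval v q)
  | .join p q => A.join (A.eval v p) (A.eval v q)
  | .imp p q => A.imp (A.eval v p) (A.eval v q)
  | .mul p q => A.mul (A.eval v p) (A.eval v q)
  | .neg p => A.neg (A.eval v p)
  | .bang p => A.bang (A.eval v p)
  | .one => A.one
  | .zero => A.zero
  | .top => A.top
  | .bot => A.bot

/-- The lattice order: `a ≤ b` means `a ∧ b = a`. -/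
def le (A : LLAlgebra.{u}) (a b : A.carrier) : Prop := A.meet a b = a

/-- The reduct `(A, ∨, ∧, →, ·, 1)` is a commutative residuated lattice. -/
structure IsCommResiduatedLattice (A : LLAlgebra.{u}) : Prop where
  meet_comm : ∀ a b, A.meet a b = A.meet b a
  meet_assoc : ∀ a b c, A.meet (A.meet a b) c = A.meet a (A.meet b c)
  join_comm : ∀ a b, A.join a b = A.join b a
  join_assoc : ∀ a b c, A.join (A.join a b) c = A.join a (A.join b c)
  meet_join_self : ∀ a b, A.meet a (A.join a b) = a
  join_meet_self : ∀ a b, A.join a (A.meet a b) = a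
  mul_comm : ∀ a b, A.mul a b = A.mul b a
  mul_assoc : ∀ a b c, A.mul (A.mul a b) c = A.mul a (A.mul b c)
  one_mul : ∀ a, A.mul A.one a = a
  residuation : ∀ a b c, A.le (A.mul a b) c ↔ A.le b (A.imp a c)

/-- The reduct `(A, ∨, ∧, →, ·, 0, 1)`, with `¬a = a → 0`, is a Girard algebra. -/
structure IsGirardAlgebra (A : LLAlgebra.{u}) : Prop extends IsCommResiduatedLattice A where
  zero_involutive : ∀ a, A.imp (A.imp a A.zero) A.zero = a
  neg_eq : ∀ a, A.neg a = A.imp a A.zero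

/-- The reduct without the exponential is a bounded Girard algebra, with `⊥ = ¬⊤`. -/
structure IsBoundedGirardAlgebra (A : LLAlgebra.{u}) : Prop extends IsGirardAlgebra A where
  one_le_imp_top : ∀ a, A.le A.one (A.imp a A.top)
  bot_eq : A.bot = A.neg A.top

/-- `A` is a bounded girale. -/
structure IsBoundedGirale (A : LLAlgebra.{u}) : Prop extends IsBoundedGirardAlgebra A where
  bang_one : A.bang A.one = A.one
  bang_le : ∀ a, A.le (A.bang a) (A.meet a A.one)
  bang_mul_bang : ∀ a b, A.mul (A.bang a) (A.bang b) = A.bang (A.meet a b)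
  bang_bang : ∀ a, A.bang (A.bang a) = A.bang a

end LLAlgebra

/-- The class of bounded girales. -/
def boundedGirales : Set LLAlgebra.{u} := {A | A.IsBoundedGirale}

/-- An equation `t₁ ≈ t₂`. -/
abbrev Equation : Type := Fm × Fm

/-- The equation `e` holds in `A` under the assignment `v`. -/
def Equation.HoldsAt (e : Equation) (A : LLAlgebra.{u}) (v : ℕ → A.carrier) : Prop :=
  A.eval v e.1 = A.eval v e.2

/-- `Θ ⊨_K e`, the equational consequence relation of a class `K` of algebras. -/
def EqConsequence (K : Set LLAlgebra.{u}) (Θ : Set Equation) (e : Equation) : Prop :=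
  ∀ A ∈ K, ∀ v : ℕ → A.carrier, (∀ t ∈ Θ, t.HoldsAt A v) → e.HoldsAt A v

/-- A variety: a class of algebras axiomatized by a set of equations. -/
def IsVariety (K : Set LLAlgebra.{u}) : Prop :=
  ∃ Ax : Set Equation, ∀ A : LLAlgebra.{u},
    A ∈ K ↔ ∀ e ∈ Ax, ∀ v : ℕ → A.carrier, e.HoldsAt A v

/-- A quasivariety: a class of algebras axiomatized by a set of quasi-equations, that is,
implications from a finite set of equations to an equation. -/
def IsQuasivariety (K : Set LLAlgebra.{u}) : Prop :=
  ∃ Ax : Set (Finset Equation × Equation), ∀ A : LLAlgebra.{u},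
    A ∈ K ↔ ∀ e ∈ Ax, ∀ v : ℕ → A.carrier, (∀ t ∈ e.1, t.HoldsAt A v) → e.2.HoldsAt A v

/-- `E(p)`: the instances at the formula `p` of a set `E` of equations in one variable. -/
def eqInst (E : Finset Equation) (p : Fm) : Set Equation :=
  {e | ∃ d ∈ E, e = (d.1.inst₁ p, d.2.inst₁ p)}

/-- `D(p, q)`: the instances at `p, q` of a set `D` of formulas in two variables. -/
def fmInst (D : Finset Fm) (p q : Fm) : Set Fm :=
  {r | ∃ d ∈ D, r = d.inst₂ p q}

/-- `K` is an algebraic semantics of `S` with defining equations `E`: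
`Γ ⊢_S p` if and only if `{E(q) : q ∈ Γ} ⊨_K E(p)`. -/
def IsAlgebraicSemantics (S : DeductiveSystem) (K : Set LLAlgebra.{u}) (E : Finset Equation) :
    Prop :=
  (∀ d ∈ E, d.1.vars ⊆ {0} ∧ d.2.vars ⊆ {0}) ∧
  ∀ (Γ : Set Fm) (p : Fm),
    S.cons Γ p ↔ ∀ e ∈ eqInst E p, EqConsequence K (⋃ q ∈ Γ, eqInst E q) e

/-- `K` is an equivalent algebraic semantics of `S` in the sense of Blok and Pigozzi: it is an
algebraic semantics with a finite set `E` of defining equations, and there is a finite set `D` of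
equivalence formulas such that `p ≈ q` and `E(D(p, q))` are interderivable in `⊨_K`. -/
def IsEquivalentAlgebraicSemantics (S : DeductiveSystem) (K : Set LLAlgebra.{u}) : Prop :=
  ∃ (E : Finset Equation) (D : Finset Fm),
    IsAlgebraicSemantics S K E ∧
    (∀ d ∈ D, d.vars ⊆ {0, 1}) ∧
    ∀ p q : Fm,
      (∀ r ∈ fmInst D p q, ∀ e ∈ eqInst E r, EqConsequence K {(p, q)} e) ∧
      EqConsequence K (⋃ r ∈ fmInst D p q, eqInst E r) (p, q)

/-- `K` is *the* equivalent algebraic semantics of `S`: the unique quasivariety that is an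
equivalent algebraic semantics of `S`. -/
def IsTheEquivalentAlgebraicSemantics (S : DeductiveSystem) (K : Set LLAlgebra.{u}) : Prop :=
  (IsQuasivariety K ∧ IsEquivalentAlgebraicSemantics S K) ∧
  ∀ K' : Set LLAlgebra.{u},
    IsQuasivariety K' → IsEquivalentAlgebraicSemantics S K' → K' = K

/-- `S` is strongly algebraizable: it is algebraizable, and its equivalent algebraic semantics
is a variety. -/
def IsStronglyAlgebraizable (S : DeductiveSystem) : Prop :=
  ∃ K : Set LLAlgebra.{u}, IsTheEquivalentAlgebraicSemantics S K ∧ IsVariety K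

end LinearLogic

namespace LinearLogic

/-! ### Evaluation and substitution -/

/-! The translations are `E(p) = {1 ∧ p ≈ 1}` and `Δ(p, q) = {p → q, q → p}`. In a bounded girale `1
≤ a → b` iff `a ≤ b`, so `E(Δ(p, q))` says exactly `p ≈ q` by antisymmetry. That `E` translates
derivability faithfully is soundness and completeness (`llDerivable_iff`). Soundness,
`one_le_eval_of_derivable`, rests on (G1)–(G4) making `!` monotone and each `!a` an idempotent below
`1`. Completeness comes from the Lindenbaum–Tarski algebra over `Γ`, which is a bounded girale
(`lindenbaum.isBoundedGirale`) in which the canonical assignment puts above `1` exactly the formulas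
derivable from `Γ`.

Residuation is the only defining condition that is not already an equation, and
`isVariety_boundedGirales` replaces it by identities.

Uniqueness is general. An equational consequence can be read off the deductive system through `Δ`
(`eqConsequence_iff_cons`), two choices of `Δ` are interderivable (`cons_equivalence_formulas`), and
a quasivariety is determined by its equational consequence relation. -/

theorem LLAlgebra.eval_subst (A : LLAlgebra.{u}) (v : ℕ → A.carrier) (σ : ℕ → Fm) (t : Fm) :
    A.eval v (t.subst σ) = A.eval (fun n => A.eval v (σ n)) t := by
  induction t <;> simp_all [Fm.subst, LLAlgebra.eval]

theorem LLAlgebra.eval_inst₁ (A : LLAlgebra.{u}) (v : ℕ → A.carrier) (t p : Fm) :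
    A.eval v (t.inst₁ p) = A.eval (fun _ => A.eval v p) t :=
  A.eval_subst v _ t

theorem LLAlgebra.eval_inst₂ (A : LLAlgebra.{u}) (v : ℕ → A.carrier) (t p q : Fm) :
    A.eval v (t.inst₂ p q) = A.eval (fun n => if n = 0 then A.eval v p else A.eval v q) t := by
  rw [Fm.inst₂, LLAlgebra.eval_subst]
  congr 1
  funext n
  split_ifs <;> rfl

/-! ### Uniqueness of the equivalent algebraic semantics -/

theorem IsVariety.isQuasivariety {K : Set LLAlgebra.{u}} (h : IsVariety K) :
    IsQuasivariety K := by
  obtain ⟨Ax, hAx⟩ := h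
  refine ⟨(fun e => (∅, e)) '' Ax, fun A => (hAx A).trans ?_⟩
  rw [Set.forall_mem_image]
  refine forall₂_congr fun e _ => forall_congr' fun v => ?_
  exact ⟨fun h _ => h, fun h => h fun t ht => absurd ht (Finset.notMem_empty t)⟩

/-- A quasivariety is determined from below by its equational consequence relation. -/
theorem IsQuasivariety.subset_of_eqConsequence {K K' : Set LLAlgebra.{u}} (hK : IsQuasivariety K)
    (h : ∀ Θ e, EqConsequence K Θ e → EqConsequence K' Θ e) : K' ⊆ K := by
  obtain ⟨Ax, hAx⟩ := hK
  intro A hA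
  refine (hAx A).2 fun e he v hv => ?_
  -- Each axiom of `K` is itself a consequence valid in `K`, so it transfers to `K'`.
  refine h {t | t ∈ e.1} e.2 (fun B hB w hw => ?_) A hA v hv
  exact (hAx B).1 hB e he w hw

theorem Equation.holdsAt_eqInst_congr {A : LLAlgebra.{u}} {v : ℕ → A.carrier} {E : Finset Equation}
    {p q : Fm} (hpq : A.eval v p = A.eval v q) (h : ∀ e ∈ eqInst E p, e.HoldsAt A v) :
    ∀ e ∈ eqInst E q, e.HoldsAt A v := by
  rintro _ ⟨d, hd, rfl⟩
  have := h _ ⟨d, hd, rfl⟩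
  simpa only [Equation.HoldsAt, LLAlgebra.eval_inst₁, hpq] using this

/-- Two systems of equivalence formulas for the same deductive system are interderivable. -/
theorem cons_equivalence_formulas {S : DeductiveSystem} {K K' : Set LLAlgebra.{u}}
    {E E' : Finset Equation} {D D' : Finset Fm}
    (hS : IsAlgebraicSemantics S K E) (hS' : IsAlgebraicSemantics S K' E')
    (hD : ∀ p q, EqConsequence K (⋃ r ∈ fmInst D p q, eqInst E r) (p, q))
    (hD' : ∀ p q, ∀ r ∈ fmInst D' p q, ∀ e ∈ eqInst E' r, EqConsequence K' {(p, q)} e)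
    {p q r : Fm} (hr : r ∈ fmInst D' p q) : S.cons (fmInst D p q) r := by
  obtain ⟨d, hd, rfl⟩ := hr
  -- Since `p ≈ p` holds everywhere, `d(p, p)` is a theorem of `S`. In `K` the premises `D(p, q)`
  -- force `p` and `q` to have equal values, so `d(p, q)` inherits what holds of `d(p, p)`.
  have hrefl : S.cons ∅ (d.inst₂ p p) := by
    refine (hS'.2 _ _).2 fun e he A hA v _ => ?_
    refine hD' p p _ ⟨d, hd, rfl⟩ e he A hA v ?_
    rintro t rfl
    rfl
  refine (hS.2 _ _).2 fun e he A hA v hv => ?_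
  have hpq : A.eval v p = A.eval v q := hD p q A hA v hv
  refine Equation.holdsAt_eqInst_congr (p := d.inst₂ p p) ?_ (fun e' he' => ?_) e he
  · simp only [LLAlgebra.eval_inst₂, hpq]
  · exact (hS.2 _ _).1 hrefl e' he' A hA v (by simp)

/-- The equational consequence relation of an equivalent algebraic semantics is determined by
the deductive system and the equivalence formulas. -/
theorem eqConsequence_iff_cons {S : DeductiveSystem} {K : Set LLAlgebra.{u}}
    {E : Finset Equation} {D : Finset Fm} (hS : IsAlgebraicSemantics S K E)
    (hD : ∀ p q, (∀ r ∈ fmInst D p q, ∀ e ∈ eqInst E r, EqConsequence K {(p, q)} e) ∧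
      EqConsequence K (⋃ r ∈ fmInst D p q, eqInst E r) (p, q))
    (Θ : Set Equation) (e : Equation) :
    EqConsequence K Θ e ↔
      ∀ r ∈ fmInst D e.1 e.2, S.cons (⋃ t ∈ Θ, fmInst D t.1 t.2) r := by
  constructor
  · intro h r hr
    refine (hS.2 _ _).2 fun e' he' A hA v hv => ?_
    refine (hD e.1 e.2).1 r hr e' he' A hA v ?_
    rintro _ rfl
    refine h A hA v fun t ht => (hD t.1 t.2).2 A hA v fun s hs => hv s ?_
    simp only [Set.mem_iUnion] at hs ⊢
    obtain ⟨r', hr', hs⟩ := hs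
    exact ⟨r', ⟨t, ht, hr'⟩, hs⟩
  · intro h A hA v hv
    refine (hD e.1 e.2).2 A hA v fun s hs => ?_
    simp only [Set.mem_iUnion] at hs
    obtain ⟨r, hr, hs⟩ := hs
    refine (hS.2 _ _).1 (h r hr) s hs A hA v fun s' hs' => ?_
    simp only [Set.mem_iUnion] at hs'
    obtain ⟨r', ⟨t, ht, hr'⟩, hs'⟩ := hs'
    refine (hD t.1 t.2).1 r' hr' s' hs' A hA v ?_
    rintro _ rfl
    exact hv t ht

theorem IsEquivalentAlgebraicSemantics.eqConsequence_imp {S : DeductiveSystem}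
    {K K' : Set LLAlgebra.{u}} (h : IsEquivalentAlgebraicSemantics S K)
    (h' : IsEquivalentAlgebraicSemantics S K') (Θ : Set Equation) (e : Equation)
    (he : EqConsequence K Θ e) : EqConsequence K' Θ e := by
  obtain ⟨E, D, hS, -, hD⟩ := h
  obtain ⟨E', D', hS', -, hD'⟩ := h'
  rw [eqConsequence_iff_cons hS' hD']
  rw [eqConsequence_iff_cons hS hD] at he
  intro r hr
  -- The cuts compose `D'(Θ) ⊢ D(Θ) ⊢ D(e) ⊢ D'(e)`, built from the right; only the middle link uses
  -- the hypothesis on `K`.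
  refine S.cut (fun s hs => ?_) (cons_equivalence_formulas hS hS' (fun p q => (hD p q).2)
    (fun p q => (hD' p q).1) hr)
  refine S.cut (fun s' hs' => ?_) (he s hs)
  simp only [Set.mem_iUnion] at hs'
  obtain ⟨t, ht, hs'⟩ := hs'
  refine S.cut (fun w hw => S.refl ?_) (cons_equivalence_formulas hS' hS
    (fun p q => (hD' p q).2) (fun p q => (hD p q).1) hs')
  exact Set.mem_biUnion ht hw

/-- There is at most one quasivariety that is an equivalent algebraic semantics. -/
theorem IsEquivalentAlgebraicSemantics.unique {S : DeductiveSystem} {K K' : Set LLAlgebra.{u}}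
    (hK : IsQuasivariety K) (hK' : IsQuasivariety K')
    (h : IsEquivalentAlgebraicSemantics S K) (h' : IsEquivalentAlgebraicSemantics S K') :
    K' = K :=
  Set.Subset.antisymm (hK.subset_of_eqConsequence (h.eqConsequence_imp h'))
    (hK'.subset_of_eqConsequence (h'.eqConsequence_imp h))

/-! ### Arithmetic of bounded girales -/

namespace LLAlgebra

variable {A : LLAlgebra.{u}} {a b c d : A.carrier}

namespace IsCommResiduatedLattice

theorem le_refl (h : A.IsCommResiduatedLattice) (a : A.carrier) : A.le a a := by
  have := h.meet_join_self a (A.meet a a)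
  rwa [h.join_meet_self] at this

theorem le_antisymm (h : A.IsCommResiduatedLattice) (hab : A.le a b) (hba : A.le b a) :
    a = b := by
  rw [← hab, h.meet_comm, hba]

theorem le_trans (h : A.IsCommResiduatedLattice) (hab : A.le a b) (hbc : A.le b c) :
    A.le a c := by
  unfold LLAlgebra.le at *
  rw [← hab, h.meet_assoc, hbc]

theorem meet_le_left (h : A.IsCommResiduatedLattice) (a b : A.carrier) : A.le (A.meet a b) a := by
  unfold LLAlgebra.le
  rw [h.meet_comm, ← h.meet_assoc, h.le_refl a]

theorem meet_le_right (h : A.IsCommResiduatedLattice) (a b : A.carrier) :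
    A.le (A.meet a b) b := by
  rw [h.meet_comm]
  exact h.meet_le_left b a

theorem le_meet (h : A.IsCommResiduatedLattice) (hab : A.le a b) (hac : A.le a c) :
    A.le a (A.meet b c) := by
  unfold LLAlgebra.le at *
  rw [← h.meet_assoc, hab, hac]

theorem le_iff_join_eq (h : A.IsCommResiduatedLattice) : A.le a b ↔ A.join a b = b := by
  constructor
  · intro hab
    have := h.join_meet_self b a
    rwa [h.meet_comm, hab, h.join_comm] at this
  · intro hab
    have := h.meet_join_self a b
    rwa [hab] at this

theorem le_join_left (h : A.IsCommResiduatedLattice) (a b : A.carrier) : A.le a (A.join a b) :=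
  h.meet_join_self a b

theorem le_join_right (h : A.IsCommResiduatedLattice) (a b : A.carrier) :
    A.le b (A.join a b) := by
  rw [h.join_comm]
  exact h.le_join_left b a

theorem join_le (h : A.IsCommResiduatedLattice) (hac : A.le a c) (hbc : A.le b c) :
    A.le (A.join a b) c := by
  rw [h.le_iff_join_eq] at *
  rw [h.join_assoc, hbc, hac]

theorem mul_le_mul_left (h : A.IsCommResiduatedLattice) (hab : A.le a b) (c : A.carrier) :
    A.le (A.mul c a) (A.mul c b) :=
  (h.residuation _ _ _).2 (h.le_trans hab ((h.residuation _ _ _).1 (h.le_refl _)))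

theorem mul_le_mul (h : A.IsCommResiduatedLattice) (hab : A.le a b) (hcd : A.le c d) :
    A.le (A.mul a c) (A.mul b d) := by
  refine h.le_trans (h.mul_le_mul_left hcd a) ?_
  rw [h.mul_comm a, h.mul_comm b]
  exact h.mul_le_mul_left hab d

theorem mul_imp_le (h : A.IsCommResiduatedLattice) (a b : A.carrier) :
    A.le (A.mul a (A.imp a b)) b :=
  (h.residuation _ _ _).2 (h.le_refl _)

theorem one_le_imp_iff (h : A.IsCommResiduatedLattice) : A.le A.one (A.imp a b) ↔ A.le a b := by
  rw [← h.residuation, h.mul_comm, h.one_mul]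

theorem mul_left_comm (h : A.IsCommResiduatedLattice) (a b c : A.carrier) :
    A.mul a (A.mul b c) = A.mul b (A.mul a c) := by
  rw [← h.mul_assoc, h.mul_comm a, h.mul_assoc]

theorem mul_join (h : A.IsCommResiduatedLattice) (a b c : A.carrier) :
    A.mul a (A.join b c) = A.join (A.mul a b) (A.mul a c) := by
  refine h.le_antisymm ?_ (h.join_le (h.mul_le_mul_left (h.le_join_left b c) a)
    (h.mul_le_mul_left (h.le_join_right b c) a))
  rw [h.residuation]
  exact h.join_le ((h.residuation _ _ _).1 (h.le_join_left _ _))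
    ((h.residuation _ _ _).1 (h.le_join_right _ _))

theorem imp_le_imp_imp (h : A.IsCommResiduatedLattice) (a b c : A.carrier) :
    A.le (A.imp a b) (A.imp (A.imp b c) (A.imp a c)) := by
  rw [← h.residuation, ← h.residuation, h.mul_left_comm, h.mul_comm _ (A.mul a _)]
  exact h.le_trans (h.mul_le_mul (h.mul_imp_le a b) (h.le_refl _)) (h.mul_imp_le b c)

theorem imp_imp_le_imp_imp (h : A.IsCommResiduatedLattice) (a b c : A.carrier) :
    A.le (A.imp a (A.imp b c)) (A.imp b (A.imp a c)) := by
  rw [← h.residuation, ← h.residuation, h.mul_left_comm]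
  exact h.le_trans (h.mul_le_mul_left (h.mul_imp_le a _) b) (h.mul_imp_le b c)

theorem imp_imp_le_mul_imp (h : A.IsCommResiduatedLattice) (a b c : A.carrier) :
    A.le (A.imp a (A.imp b c)) (A.imp (A.mul a b) c) := by
  rw [← h.residuation, h.mul_comm a b, h.mul_assoc]
  exact h.le_trans (h.mul_le_mul_left (h.mul_imp_le a _) b) (h.mul_imp_le b c)

theorem imp_meet_imp_le (h : A.IsCommResiduatedLattice) (a b c : A.carrier) :
    A.le (A.meet (A.imp a b) (A.imp a c)) (A.imp a (A.meet b c)) := by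
  rw [← h.residuation]
  exact h.le_meet ((h.residuation _ _ _).2 (h.meet_le_left _ _))
    ((h.residuation _ _ _).2 (h.meet_le_right _ _))

theorem imp_meet_imp_le_join_imp (h : A.IsCommResiduatedLattice) (a b c : A.carrier) :
    A.le (A.meet (A.imp a c) (A.imp b c)) (A.imp (A.join a b) c) := by
  rw [← h.residuation, h.mul_comm, h.residuation]
  refine h.join_le ?_ ?_ <;> rw [← h.residuation, h.mul_comm, h.residuation]
  · exact h.meet_le_left _ _
  · exact h.meet_le_right _ _

end IsCommResiduatedLattice

namespace IsBoundedGirale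

theorem le_top (h : A.IsBoundedGirale) (a : A.carrier) : A.le a A.top :=
  h.one_le_imp_iff.1 (h.one_le_imp_top a)

/-- Negation is antitone, so `¬a ≤ ⊤` gives `⊥ = ¬⊤ ≤ ¬¬a = a`. -/
theorem bot_le (h : A.IsBoundedGirale) (a : A.carrier) : A.le A.bot a := by
  have : A.le (A.imp A.top A.zero) (A.imp (A.imp a A.zero) A.zero) :=
    (h.residuation _ _ _).1
      (h.le_trans (h.mul_le_mul (h.le_top _) (h.le_refl _)) (h.mul_imp_le _ _))
  rwa [h.zero_involutive, ← h.neg_eq, ← h.bot_eq] at this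

theorem bang_le_self (h : A.IsBoundedGirale) (a : A.carrier) : A.le (A.bang a) a :=
  h.le_trans (h.bang_le a) (h.meet_le_left _ _)

theorem bang_le_one (h : A.IsBoundedGirale) (a : A.carrier) : A.le (A.bang a) A.one :=
  h.le_trans (h.bang_le a) (h.meet_le_right _ _)

theorem bang_mul_le (h : A.IsBoundedGirale) (a b : A.carrier) : A.le (A.mul (A.bang a) b) b := by
  have := h.mul_le_mul (h.bang_le_one a) (h.le_refl b)
  rwa [h.one_mul] at this

/-- Contraction for `!`: this is (G3) with both arguments equal. -/
theorem bang_mul_self (h : A.IsBoundedGirale) (a : A.carrier) :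
    A.mul (A.bang a) (A.bang a) = A.bang a := by
  rw [h.bang_mul_bang, h.le_refl a]

/-- If `a ∧ b = a`, then (G3) gives `!a = !a · !b`, which is below `!b` because `!a ≤ 1`. -/
theorem bang_mono (h : A.IsBoundedGirale) (hab : A.le a b) : A.le (A.bang a) (A.bang b) := by
  have := h.bang_mul_le a (A.bang b)
  rwa [h.bang_mul_bang, hab] at this

/-- The product `!a · !(a → b)` is below `b`, and by (G3) it has the form `!c`, so (G4) makes it a
fixed point of `!`. Monotonicity then puts it below `!b`. -/
theorem bang_imp_le (h : A.IsBoundedGirale) (a b : A.carrier) :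
    A.le (A.bang (A.imp a b)) (A.imp (A.bang a) (A.bang b)) := by
  rw [← h.residuation]
  have key : A.le (A.mul (A.bang a) (A.bang (A.imp a b))) b :=
    h.le_trans (h.mul_le_mul (h.bang_le_self _) (h.bang_le_self _)) (h.mul_imp_le a b)
  have := h.bang_mono key
  rwa [h.bang_mul_bang, h.bang_bang, ← h.bang_mul_bang] at this

theorem bang_imp_bang_imp_le (h : A.IsBoundedGirale) (a b : A.carrier) :
    A.le (A.imp (A.bang a) (A.imp (A.bang a) b)) (A.imp (A.bang a) b) := by
  have := h.imp_imp_le_mul_imp (A.bang a) (A.bang a) b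
  rwa [h.bang_mul_self] at this

/-! ### Soundness -/

theorem one_le_eval_of_llAxiom (h : A.IsBoundedGirale) (v : ℕ → A.carrier) {p : Fm}
    (hp : LLAxiom p) : A.le A.one (A.eval v p) := by
  cases hp with
  | hl1 p => exact h.one_le_imp_iff.2 (h.le_refl _)
  | hl2 p q r => exact h.one_le_imp_iff.2 (h.imp_le_imp_imp _ _ _)
  | hl3 p q r => exact h.one_le_imp_iff.2 (h.imp_imp_le_imp_imp _ _ _)
  | hl4 p =>
    refine h.one_le_imp_iff.2 ?_
    simp only [eval, h.neg_eq, h.zero_involutive]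
    exact h.le_refl _
  | hl5 p q =>
    refine h.one_le_imp_iff.2 ?_
    simp only [eval, h.neg_eq]
    exact h.imp_imp_le_imp_imp _ _ _
  | hl6 p q =>
    refine h.one_le_imp_iff.2 ((h.residuation _ _ _).1 ?_)
    rw [h.mul_comm]
    exact h.le_refl _
  | hl7 p q r => exact h.one_le_imp_iff.2 (h.imp_imp_le_mul_imp _ _ _)
  | hl8 => exact h.le_refl _
  | hl9 p => exact h.one_le_imp_iff.2 (h.one_le_imp_iff.2 (h.le_refl _))
  | hl10 p =>
    refine h.one_le_imp_iff.2 ((h.residuation _ _ _).1 ?_)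
    rw [eval, h.neg_eq, h.mul_comm]
    exact h.mul_imp_le _ _
  | hl11 =>
    rw [eval, h.neg_eq]
    exact h.one_le_imp_iff.2 (h.le_refl _)
  | hl12 p q => exact h.one_le_imp_iff.2 (h.meet_le_left _ _)
  | hl13 p q => exact h.one_le_imp_iff.2 (h.meet_le_right _ _)
  | hl14 p q r => exact h.one_le_imp_iff.2 (h.imp_meet_imp_le _ _ _)
  | hl15 p q => exact h.one_le_imp_iff.2 (h.le_join_left _ _)
  | hl16 p q => exact h.one_le_imp_iff.2 (h.le_join_right _ _)
  | hl17 p q r => exact h.one_le_imp_iff.2 (h.imp_meet_imp_le_join_imp _ _ _)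
  | hl18 p => exact h.one_le_imp_iff.2 (h.le_top _)
  | hl19 p => exact h.one_le_imp_iff.2 (h.bot_le _)
  | hl20 p q => exact h.one_le_imp_iff.2 ((h.residuation _ _ _).1 (h.bang_mul_le _ _))
  | hl21 p q => exact h.one_le_imp_iff.2 (h.bang_imp_bang_imp_le _ _)
  | hl22 p q => exact h.one_le_imp_iff.2 (h.bang_imp_le _ _)
  | hl23 p => exact h.one_le_imp_iff.2 (h.bang_le_self _)
  | hl24 p =>
    refine h.one_le_imp_iff.2 ?_
    simp only [eval, h.bang_bang]
    exact h.le_refl _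

theorem one_le_eval_of_derivable (h : A.IsBoundedGirale) (v : ℕ → A.carrier) {Γ : Set Fm}
    (hΓ : ∀ q ∈ Γ, A.le A.one (A.eval v q)) {p : Fm} (hp : LLDerivable Γ p) :
    A.le A.one (A.eval v p) := by
  induction hp with
  | hyp hq => exact hΓ _ hq
  | ax hp => exact h.one_le_eval_of_llAxiom v hp
  | mp _ _ ih₁ ih₂ => exact h.le_trans ih₁ (h.one_le_imp_iff.1 ih₂)
  | adj _ _ ih₁ ih₂ => exact h.le_meet ih₁ ih₂
  | nec _ ih =>
    have := h.bang_mono ih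
    rwa [h.bang_one] at this

end IsBoundedGirale

end LLAlgebra

/-! ### Bounded girales form a variety -/

theorem isVariety_boundedGirales : IsVariety boundedGirales.{u} := by
  -- The axioms are all identities valid in every bounded girale; it remains to recover the
  -- definition from them.
  refine ⟨{e | ∀ B ∈ boundedGirales.{u}, ∀ w : ℕ → B.carrier, e.HoldsAt B w}, fun A =>
    ⟨fun hA e he v => he A hA v, fun hA => ?_⟩⟩
  have key (s t : Fm)
      (hst : ∀ B : LLAlgebra.{u}, B.IsBoundedGirale → ∀ w, B.eval w s = B.eval w t)
      (a b c : A.carrier) :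
      A.eval (fun n => match n with | 0 => a | 1 => b | _ => c) s =
        A.eval (fun n => match n with | 0 => a | 1 => b | _ => c) t :=
    hA (s, t) hst _
  let x := Fm.var 0
  let y := Fm.var 1
  let z := Fm.var 2
  have meet_comm (a b) : A.meet a b = A.meet b a :=
    key (x ⋏ y) (y ⋏ x) (fun B hB w => hB.meet_comm _ _) a b a
  have meet_assoc (a b c) : A.meet (A.meet a b) c = A.meet a (A.meet b c) :=
    key (x ⋏ y ⋏ z) (x ⋏ (y ⋏ z)) (fun B hB w => hB.meet_assoc _ _ _) a b c
  have join_comm (a b) : A.join a b = A.join b a :=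
    key (x ⋎ y) (y ⋎ x) (fun B hB w => hB.join_comm _ _) a b a
  have meet_join_self (a b) : A.meet a (A.join a b) = a :=
    key (x ⋏ (x ⋎ y)) x (fun B hB w => hB.meet_join_self _ _) a b a
  have join_meet_self (a b) : A.join a (A.meet a b) = a :=
    key (x ⋎ (x ⋏ y)) x (fun B hB w => hB.join_meet_self _ _) a b a
  -- Together with the lattice laws, this identity and the next two, `a(a → b) ≤ b` and `b ≤ a → (ab
  -- ∨ c)`, are equivalent to residuation.
  have mul_join (a b c) : A.mul a (A.join b c) = A.join (A.mul a b) (A.mul a c) :=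
    key (x ⊙ (y ⋎ z)) (x ⊙ y ⋎ x ⊙ z) (fun B hB w => hB.mul_join _ _ _) a b c
  have mul_imp_le (a b) : A.meet (A.mul a (A.imp a b)) b = A.mul a (A.imp a b) :=
    key (x ⊙ (x ⊸ y) ⋏ y) (x ⊙ (x ⊸ y)) (fun B hB w => hB.mul_imp_le _ _) a b a
  have le_imp_mul_join (a b c) : A.meet b (A.imp a (A.join (A.mul a b) c)) = b :=
    key (y ⋏ (x ⊸ x ⊙ y ⋎ z)) y
      (fun B hB w => (hB.residuation _ _ _).1 (hB.le_join_left _ _)) a b c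
  exact {
    meet_comm := meet_comm
    meet_assoc := meet_assoc
    join_comm := join_comm
    join_assoc := key (x ⋎ y ⋎ z) (x ⋎ (y ⋎ z)) fun B hB w => hB.join_assoc _ _ _
    meet_join_self := meet_join_self
    join_meet_self := join_meet_self
    mul_comm := fun a b => key (x ⊙ y) (y ⊙ x) (fun B hB w => hB.mul_comm _ _) a b a
    mul_assoc := key (x ⊙ y ⊙ z) (x ⊙ (y ⊙ z)) fun B hB w => hB.mul_assoc _ _ _
    one_mul := fun a => key (Fm.one ⊙ x) x (fun B hB w => hB.one_mul _) a a a
    residuation := by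
      intro a b c
      unfold LLAlgebra.le
      constructor
      -- When `ab ≤ c`, the join `ab ∨ c` collapses to `c` in `b ≤ a → (ab ∨ c)`.
      · intro h
        have hc := join_meet_self c (A.mul a b)
        rw [meet_comm, h, join_comm] at hc
        have := le_imp_mul_join a b c
        rwa [hc] at this
      -- When `b ≤ a → c`, distributivity gives `ab ≤ a(a → c)`, which is below `c`.
      · intro h
        have hr := join_meet_self (A.imp a c) b
        rw [meet_comm, h, join_comm] at hr
        have hm := meet_join_self (A.mul a b) (A.mul a (A.imp a c))
        rw [← mul_join, hr] at hm
        rw [← hm, meet_assoc, mul_imp_le]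
    zero_involutive := fun a => key ((x ⊸ Fm.zero) ⊸ Fm.zero) x
      (fun B hB w => hB.zero_involutive _) a a a
    neg_eq := fun a => key x.neg (x ⊸ Fm.zero) (fun B hB w => hB.neg_eq _) a a a
    one_le_imp_top := fun a => key (Fm.one ⋏ (x ⊸ Fm.top)) Fm.one
      (fun B hB w => hB.one_le_imp_top _) a a a
    bot_eq := key Fm.bot Fm.top.neg (fun B hB w => hB.bot_eq) A.one A.one A.one
    bang_one := key Fm.one.bang Fm.one (fun B hB w => hB.bang_one) A.one A.one A.one
    bang_le := fun a => key (x.bang ⋏ (x ⋏ Fm.one)) x.bang (fun B hB w => hB.bang_le _) a a a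
    bang_mul_bang := fun a b => key (x.bang ⊙ y.bang) (x ⋏ y).bang
      (fun B hB w => hB.bang_mul_bang _ _) a b a
    bang_bang := fun a => key x.bang.bang x.bang (fun B hB w => hB.bang_bang _) a a a }

/-! ### Derivations in linear logic -/

namespace LLDerivable

variable {Γ : Set Fm} {p q r p' q' : Fm}

theorem imp_refl (p : Fm) : LLDerivable Γ (p ⊸ p) := .ax (.hl1 p)

theorem imp_trans (h₁ : LLDerivable Γ (p ⊸ q)) (h₂ : LLDerivable Γ (q ⊸ r)) :
    LLDerivable Γ (p ⊸ r) :=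
  .mp h₂ (.mp h₁ (.ax (.hl2 p q r)))

theorem imp_swap (h : LLDerivable Γ (p ⊸ q ⊸ r)) : LLDerivable Γ (q ⊸ p ⊸ r) :=
  .mp h (.ax (.hl3 p q r))

theorem imp_mono (h₁ : LLDerivable Γ (p' ⊸ p)) (h₂ : LLDerivable Γ (q ⊸ q')) :
    LLDerivable Γ ((p ⊸ q) ⊸ (p' ⊸ q')) :=
  imp_trans (.mp h₁ (.ax (.hl2 p' p q))) (.mp h₂ (imp_swap (.ax (.hl2 p' q q'))))

theorem mul_imp_iff : LLDerivable Γ (p ⊙ q ⊸ r) ↔ LLDerivable Γ (p ⊸ q ⊸ r) :=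
  ⟨fun h => imp_trans (.ax (.hl6 p q)) (imp_mono (imp_refl q) h),
    fun h => .mp h (.ax (.hl7 p q r))⟩

theorem imp_mul (p q : Fm) : LLDerivable Γ (p ⊸ q ⊸ p ⊙ q) := .ax (.hl6 p q)

theorem mul_comm (p q : Fm) : LLDerivable Γ (p ⊙ q ⊸ q ⊙ p) :=
  mul_imp_iff.2 (imp_swap (imp_mul q p))

theorem mul_mono (h₁ : LLDerivable Γ (p ⊸ p')) (h₂ : LLDerivable Γ (q ⊸ q')) :
    LLDerivable Γ (p ⊙ q ⊸ p' ⊙ q') :=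
  mul_imp_iff.2 (imp_trans h₁ (imp_trans (imp_mul p' q') (imp_mono h₂ (imp_refl _))))

theorem mul_assoc (p q r : Fm) : LLDerivable Γ (p ⊙ q ⊙ r ⊸ p ⊙ (q ⊙ r)) :=
  mul_imp_iff.2 (mul_imp_iff.2 (imp_swap (imp_trans (imp_mul q r)
    (imp_trans (imp_mono (imp_refl r) (imp_swap (imp_mul p (q ⊙ r)))) (.ax (.hl3 _ _ _))))))

theorem mul_assoc_symm (p q r : Fm) : LLDerivable Γ (p ⊙ (q ⊙ r) ⊸ p ⊙ q ⊙ r) :=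
  mul_imp_iff.2 (imp_trans (mul_imp_iff.1 (imp_mul (p ⊙ q) r)) (.ax (.hl7 _ _ _)))

theorem meet_left (p q : Fm) : LLDerivable Γ (p ⋏ q ⊸ p) := .ax (.hl12 p q)

theorem meet_right (p q : Fm) : LLDerivable Γ (p ⋏ q ⊸ q) := .ax (.hl13 p q)

theorem imp_meet (h₁ : LLDerivable Γ (p ⊸ q)) (h₂ : LLDerivable Γ (p ⊸ r)) :
    LLDerivable Γ (p ⊸ q ⋏ r) :=
  .mp (.adj h₁ h₂) (.ax (.hl14 p q r))

theorem join_left (p q : Fm) : LLDerivable Γ (p ⊸ p ⋎ q) := .ax (.hl15 p q)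

theorem join_right (p q : Fm) : LLDerivable Γ (q ⊸ p ⋎ q) := .ax (.hl16 p q)

theorem join_imp (h₁ : LLDerivable Γ (p ⊸ r)) (h₂ : LLDerivable Γ (q ⊸ r)) :
    LLDerivable Γ (p ⋎ q ⊸ r) :=
  .mp (.adj h₁ h₂) (.ax (.hl17 p q r))

theorem meet_mono (h₁ : LLDerivable Γ (p ⊸ p')) (h₂ : LLDerivable Γ (q ⊸ q')) :
    LLDerivable Γ (p ⋏ q ⊸ p' ⋏ q') :=
  imp_meet (imp_trans (meet_left p q) h₁) (imp_trans (meet_right p q) h₂)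

theorem join_mono (h₁ : LLDerivable Γ (p ⊸ p')) (h₂ : LLDerivable Γ (q ⊸ q')) :
    LLDerivable Γ (p ⋎ q ⊸ p' ⋎ q') :=
  join_imp (imp_trans h₁ (join_left p' q')) (imp_trans h₂ (join_right p' q'))

/-- This makes derivability correspond to lying above `1` in the Lindenbaum–Tarski algebra. -/
theorem one_imp_iff : LLDerivable Γ (Fm.one ⊸ p) ↔ LLDerivable Γ p :=
  ⟨fun h => .mp (.ax .hl8) h, fun h => .mp h (imp_swap (.ax (.hl9 p)))⟩

theorem imp_neg_neg (p : Fm) : LLDerivable Γ (p ⊸ p.neg.neg) :=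
  .mp (imp_refl p.neg) (.ax (.hl5 p.neg p))

theorem neg_mono (h : LLDerivable Γ (p ⊸ q)) : LLDerivable Γ (q.neg ⊸ p.neg) :=
  .mp (imp_trans h (imp_neg_neg q)) (.ax (.hl5 p q.neg))

theorem neg_imp_imp_zero (p : Fm) : LLDerivable Γ (p.neg ⊸ (p ⊸ Fm.zero)) :=
  imp_swap (.ax (.hl10 p))

/-- Weaken `0` to `¬¬0`, contrapose by (HL5) to `¬0 → ¬p`, and discharge `¬0` by (HL11). -/
theorem imp_zero_imp_neg (p : Fm) : LLDerivable Γ ((p ⊸ Fm.zero) ⊸ p.neg) :=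
  imp_trans (imp_mono (imp_refl p) (imp_neg_neg Fm.zero))
    (.mp (.ax .hl11) (imp_swap (.ax (.hl5 p Fm.zero.neg))))

theorem bang_mono (h : LLDerivable Γ (p ⊸ q)) : LLDerivable Γ (p.bang ⊸ q.bang) :=
  .mp (.nec h) (.ax (.hl22 p q))

theorem bang_imp_one (p : Fm) : LLDerivable Γ (p.bang ⊸ Fm.one) :=
  .mp (.ax .hl8) (.ax (.hl20 p Fm.one))

/-- Weakening (HL20) yields `!p → (!q → p ∧ q)`. Applying `!` to it and distributing by (HL22) gives
`!!p → (!!q → !(p ∧ q))`, and (HL24) removes the doubled exponentials. -/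
theorem bang_mul_bang_imp (p q : Fm) : LLDerivable Γ (p.bang ⊙ q.bang ⊸ (p ⋏ q).bang) := by
  have h : LLDerivable Γ (p.bang ⊸ (q.bang ⊸ p ⋏ q)) := by
    refine mul_imp_iff.1 (imp_meet (mul_imp_iff.2 ?_) (mul_imp_iff.2 ?_))
    · exact imp_trans (.ax (.hl23 p)) (.ax (.hl20 q p))
    · exact imp_swap (imp_trans (.ax (.hl23 q)) (.ax (.hl20 p q)))
  exact mul_imp_iff.2 (imp_trans (.ax (.hl24 p)) (imp_trans (bang_mono h)
    (imp_trans (.ax (.hl22 _ _)) (imp_mono (.ax (.hl24 q)) (imp_refl _)))))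

/-- One copy of `!(p ∧ q)` yields `!p` and another yields `!q`; (HL21) contracts the two copies. -/
theorem bang_imp_bang_mul (p q : Fm) : LLDerivable Γ ((p ⋏ q).bang ⊸ p.bang ⊙ q.bang) :=
  .mp (imp_trans (bang_mono (meet_left p q)) (imp_trans (imp_mul p.bang q.bang)
    (imp_mono (bang_mono (meet_right p q)) (imp_refl _)))) (.ax (.hl21 (p ⋏ q) _))

end LLDerivable

/-! ### The Lindenbaum–Tarski algebra of a set of premises -/

/-- Provable equivalence of formulas from the premises `Γ`. -/
def lindenbaumSetoid (Γ : Set Fm) : Setoid Fm where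
  r p q := LLDerivable Γ (p ⊸ q) ∧ LLDerivable Γ (q ⊸ p)
  iseqv :=
    { refl := fun p => ⟨.imp_refl p, .imp_refl p⟩
      symm := fun h => ⟨h.2, h.1⟩
      trans := fun h₁ h₂ => ⟨.imp_trans h₁.1 h₂.1, .imp_trans h₂.2 h₁.2⟩ }

/-- The Lindenbaum–Tarski algebra of linear logic over the premises `Γ`. -/
def lindenbaum (Γ : Set Fm) : LLAlgebra.{u} where
  -- Formulas live in `Type`; the lift places the quotient in the universe `u` of the class under
  -- study.
  carrier := ULift.{u} (Quotient (lindenbaumSetoid Γ))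
  meet a b := ⟨Quotient.map₂ Fm.meet (fun _ _ (h₁ : _ ∧ _) _ _ (h₂ : _ ∧ _) =>
    ⟨.meet_mono h₁.1 h₂.1, .meet_mono h₁.2 h₂.2⟩) a.down b.down⟩
  join a b := ⟨Quotient.map₂ Fm.join (fun _ _ (h₁ : _ ∧ _) _ _ (h₂ : _ ∧ _) =>
    ⟨.join_mono h₁.1 h₂.1, .join_mono h₁.2 h₂.2⟩) a.down b.down⟩
  imp a b := ⟨Quotient.map₂ Fm.imp (fun _ _ (h₁ : _ ∧ _) _ _ (h₂ : _ ∧ _) =>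
    ⟨.imp_mono h₁.2 h₂.1, .imp_mono h₁.1 h₂.2⟩) a.down b.down⟩
  mul a b := ⟨Quotient.map₂ Fm.mul (fun _ _ (h₁ : _ ∧ _) _ _ (h₂ : _ ∧ _) =>
    ⟨.mul_mono h₁.1 h₂.1, .mul_mono h₁.2 h₂.2⟩) a.down b.down⟩
  neg a := ⟨Quotient.map Fm.neg (fun _ _ (h : _ ∧ _) => ⟨.neg_mono h.2, .neg_mono h.1⟩) a.down⟩
  bang a := ⟨Quotient.map Fm.bang (fun _ _ (h : _ ∧ _) => ⟨.bang_mono h.1, .bang_mono h.2⟩) a.down⟩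
  one := ⟨Quotient.mk _ Fm.one⟩
  zero := ⟨Quotient.mk _ Fm.zero⟩
  top := ⟨Quotient.mk _ Fm.top⟩
  bot := ⟨Quotient.mk _ Fm.bot⟩

namespace lindenbaum

variable {Γ : Set Fm} {p q : Fm}

/-- The class of a formula in the Lindenbaum–Tarski algebra. -/
def mk (Γ : Set Fm) (p : Fm) : (lindenbaum.{u} Γ).carrier :=
  ⟨Quotient.mk (lindenbaumSetoid Γ) p⟩

theorem mk_surjective (Γ : Set Fm) : Function.Surjective (mk.{u} Γ) := by
  rintro ⟨⟨p⟩⟩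
  exact ⟨p, rfl⟩

theorem mk_eq_iff :
    mk.{u} Γ p = mk.{u} Γ q ↔ LLDerivable Γ (p ⊸ q) ∧ LLDerivable Γ (q ⊸ p) :=
  ULift.up_injective.eq_iff.trans Quotient.eq

theorem mk_eq (h₁ : LLDerivable Γ (p ⊸ q)) (h₂ : LLDerivable Γ (q ⊸ p)) :
    mk.{u} Γ p = mk.{u} Γ q :=
  mk_eq_iff.2 ⟨h₁, h₂⟩

theorem le_mk_iff : (lindenbaum.{u} Γ).le (mk Γ p) (mk Γ q) ↔ LLDerivable Γ (p ⊸ q) :=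
  mk_eq_iff.trans ⟨fun h => .imp_trans h.2 (.meet_right p q),
    fun h => ⟨.meet_left p q, .imp_meet (.imp_refl p) h⟩⟩

/-- The canonical assignment, on which completeness rests. -/
theorem eval_mk (Γ : Set Fm) (p : Fm) :
    (lindenbaum.{u} Γ).eval (fun n => mk Γ (.var n)) p = mk Γ p := by
  induction p with
  | var n => rfl
  | meet p q ih₁ ih₂ => rw [LLAlgebra.eval, ih₁, ih₂]; rfl
  | join p q ih₁ ih₂ => rw [LLAlgebra.eval, ih₁, ih₂]; rfl
  | imp p q ih₁ ih₂ => rw [LLAlgebra.eval, ih₁, ih₂]; rfl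
  | mul p q ih₁ ih₂ => rw [LLAlgebra.eval, ih₁, ih₂]; rfl
  | neg p ih => rw [LLAlgebra.eval, ih]; rfl
  | bang p ih => rw [LLAlgebra.eval, ih]; rfl
  | one => rfl
  | zero => rfl
  | top => rfl
  | bot => rfl

open LLDerivable in
theorem isBoundedGirale (Γ : Set Fm) : (lindenbaum.{u} Γ).IsBoundedGirale where
  meet_comm := (mk_surjective Γ).forall₂.2 fun p q => mk_eq
    (imp_meet (meet_right p q) (meet_left p q)) (imp_meet (meet_right q p) (meet_left q p))
  meet_assoc := (mk_surjective Γ).forall₃.2 fun _ _ _ => mk_eq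
    (imp_meet (imp_trans (meet_left _ _) (meet_left _ _))
      (meet_mono (meet_right _ _) (imp_refl _)))
    (imp_meet (meet_mono (imp_refl _) (meet_left _ _))
      (imp_trans (meet_right _ _) (meet_right _ _)))
  join_comm := (mk_surjective Γ).forall₂.2 fun p q => mk_eq
    (join_imp (join_right q p) (join_left q p)) (join_imp (join_right p q) (join_left p q))
  join_assoc := (mk_surjective Γ).forall₃.2 fun _ _ _ => mk_eq
    (join_imp (join_mono (imp_refl _) (join_left _ _))
      (imp_trans (join_right _ _) (join_right _ _)))
    (join_imp (imp_trans (join_left _ _) (join_left _ _))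
      (join_mono (join_right _ _) (imp_refl _)))
  meet_join_self := (mk_surjective Γ).forall₂.2 fun _ _ => mk_eq
    (meet_left _ _) (imp_meet (imp_refl _) (join_left _ _))
  join_meet_self := (mk_surjective Γ).forall₂.2 fun _ _ => mk_eq
    (join_imp (imp_refl _) (meet_left _ _)) (join_left _ _)
  mul_comm := (mk_surjective Γ).forall₂.2 fun p q => mk_eq (LLDerivable.mul_comm p q)
    (LLDerivable.mul_comm q p)
  mul_assoc := (mk_surjective Γ).forall₃.2 fun p q r => mk_eq (LLDerivable.mul_assoc p q r)
    (LLDerivable.mul_assoc_symm p q r)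
  one_mul := (mk_surjective Γ).forall.2 fun p => mk_eq
    (mul_imp_iff.2 (.ax (.hl9 p))) (.mp (.ax .hl8) (imp_mul Fm.one p))
  -- Currying gives `p → (q → r)`, while the law puts the second factor on the left of `≤`; hence
  -- the exchange.
  residuation := (mk_surjective Γ).forall₃.2 fun p q r =>
    (le_mk_iff (p := p ⊙ q)).trans ((mul_imp_iff.trans ⟨imp_swap, imp_swap⟩).trans
      (le_mk_iff (q := p ⊸ r)).symm)
  zero_involutive := (mk_surjective Γ).forall.2 fun p => mk_eq
    (imp_trans (imp_trans (imp_zero_imp_neg _) (neg_mono (neg_imp_imp_zero p))) (.ax (.hl4 p)))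
    (imp_swap (imp_refl _))
  neg_eq := (mk_surjective Γ).forall.2 fun p => mk_eq (neg_imp_imp_zero p) (imp_zero_imp_neg p)
  one_le_imp_top := (mk_surjective Γ).forall.2 fun p =>
    (le_mk_iff (p := Fm.one) (q := p ⊸ Fm.top)).2 (one_imp_iff.2 (.ax (.hl18 p)))
  -- Conversely, contraposing `¬⊥ → ⊤` gives `¬⊤ → ¬¬⊥`, and (HL4) ends at `⊥`.
  bot_eq := mk_eq (.ax (.hl19 _))
    (imp_trans (neg_mono (.ax (.hl18 Fm.bot.neg))) (.ax (.hl4 _)))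
  bang_one := mk_eq (bang_imp_one _) (one_imp_iff.2 (.nec (.ax .hl8)))
  bang_le := (mk_surjective Γ).forall.2 fun p =>
    (le_mk_iff (p := p.bang) (q := p ⋏ Fm.one)).2 (imp_meet (.ax (.hl23 p)) (bang_imp_one p))
  bang_mul_bang := (mk_surjective Γ).forall₂.2 fun p q => mk_eq (bang_mul_bang_imp p q)
    (bang_imp_bang_mul p q)
  bang_bang := (mk_surjective Γ).forall.2 fun _ => mk_eq (.ax (.hl23 _)) (.ax (.hl24 _))

end lindenbaum

/-! ### Algebraizability of linear logic -/

/-- `p` is derivable from `Γ` if and only if `1 ≤ p` holds in every bounded girale under every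
assignment with `1 ≤ q` for all `q` in `Γ`. -/
theorem llDerivable_iff {Γ : Set Fm} {p : Fm} :
    LLDerivable Γ p ↔ ∀ A ∈ boundedGirales.{u}, ∀ v : ℕ → A.carrier,
      (∀ q ∈ Γ, A.le A.one (A.eval v q)) → A.le A.one (A.eval v p) := by
  refine ⟨fun h A hA v hv => hA.one_le_eval_of_derivable v hv h, fun h => ?_⟩
  have key (q : Fm) : (lindenbaum.{u} Γ).le (lindenbaum Γ).one
      ((lindenbaum Γ).eval (fun n => lindenbaum.mk Γ (.var n)) q) ↔ LLDerivable Γ q := by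
    rw [lindenbaum.eval_mk]
    exact lindenbaum.le_mk_iff.trans LLDerivable.one_imp_iff
  exact (key p).1 (h _ (lindenbaum.isBoundedGirale Γ) _ fun q hq => (key q).2 (.hyp hq))

/-- The defining equation `1 ∧ x ≈ 1`. -/
def oneLeEquation : Equation := (Fm.one ⋏ Fm.var 0, Fm.one)

theorem forall_mem_eqInst_oneLeEquation {P : Equation → Prop} {p : Fm} :
    (∀ e ∈ eqInst {oneLeEquation} p, P e) ↔ P (Fm.one ⋏ p, Fm.one) := by
  simp [eqInst, oneLeEquation, Fm.inst₁, Fm.subst]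

theorem isAlgebraicSemantics_boundedGirales :
    IsAlgebraicSemantics LL boundedGirales.{u} {oneLeEquation} := by
  refine ⟨by simp [oneLeEquation, Fm.vars], fun Γ p => ?_⟩
  rw [forall_mem_eqInst_oneLeEquation]
  refine (llDerivable_iff.{u} (Γ := Γ) (p := p)).trans ?_
  -- The conclusions agree definitionally, since `1 ≤ a` unfolds to `1 ∧ a = 1`; only the premises,
  -- indexed by a union over `Γ`, need rearranging.
  refine forall₂_congr fun A _ => forall_congr' fun v => imp_congr_left ?_
  simp only [Set.mem_iUnion, exists_prop, forall_exists_index, and_imp]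
  rw [forall_comm]
  refine forall_congr' fun q => ?_
  rw [forall_comm]
  refine forall_congr' fun _ => ?_
  exact (forall_mem_eqInst_oneLeEquation (P := fun e => e.HoldsAt A v)).symm

theorem isEquivalentAlgebraicSemantics_boundedGirales :
    IsEquivalentAlgebraicSemantics LL boundedGirales.{u} := by
  classical
  refine ⟨{oneLeEquation}, {Fm.var 0 ⊸ Fm.var 1, Fm.var 1 ⊸ Fm.var 0},
    isAlgebraicSemantics_boundedGirales, by simp [Fm.vars, Set.insert_subset_iff], fun p q => ?_⟩
  have hD : fmInst {Fm.var 0 ⊸ Fm.var 1, Fm.var 1 ⊸ Fm.var 0} p q = {p ⊸ q, q ⊸ p} := by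
    ext r
    simp [fmInst, Fm.inst₂, Fm.subst]
  rw [hD]
  constructor
  · intro r hr
    rw [forall_mem_eqInst_oneLeEquation]
    intro A hA v hv
    have hpq : A.eval v p = A.eval v q := hv (p, q) rfl
    rcases hr with rfl | rfl <;> refine hA.one_le_imp_iff.2 ?_ <;> rw [hpq] <;>
      exact hA.le_refl _
  · intro A hA v hv
    have key (r : Fm) (hr : r ∈ ({p ⊸ q, q ⊸ p} : Set Fm)) : A.le A.one (A.eval v r) :=
      hv (Fm.one ⋏ r, Fm.one) (Set.mem_biUnion hr
        ⟨oneLeEquation, by simp, rfl⟩)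
    exact hA.le_antisymm (hA.one_le_imp_iff.1 (key _ (Or.inl rfl)))
      (hA.one_le_imp_iff.1 (key _ (Or.inr rfl)))

theorem isTheEquivalentAlgebraicSemantics_boundedGirales :
    IsTheEquivalentAlgebraicSemantics LL boundedGirales.{u} :=
  ⟨⟨isVariety_boundedGirales.isQuasivariety, isEquivalentAlgebraicSemantics_boundedGirales⟩,
    fun _ hK' h' => IsEquivalentAlgebraicSemantics.unique isVariety_boundedGirales.isQuasivariety
      hK' isEquivalentAlgebraicSemantics_boundedGirales h'⟩

end LinearLogic

theorem mainTheorem1 :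
    LinearLogic.IsStronglyAlgebraizable.{u} LinearLogic.LL ∧
    LinearLogic.IsVariety LinearLogic.boundedGirales.{u} ∧
    LinearLogic.IsTheEquivalentAlgebraicSemantics LinearLogic.LL
      LinearLogic.boundedGirales.{u} :=
  ⟨⟨_, LinearLogic.isTheEquivalentAlgebraicSemantics_boundedGirales,
    LinearLogic.isVariety_boundedGirales⟩, LinearLogic.isVariety_boundedGirales,
    LinearLogic.isTheEquivalentAlgebraicSemantics_boundedGirales⟩
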